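/- Let $1<p<\infty$ and let $q$ be the conjugate exponent, $\frac1p+\frac1q=1$. Let $L^p([0,1])$ be the complex Lebesgue space and let $\mathsf C$ be the continuous Cesàro operator, $$\mathsf Cf(x)=\frac1x\int_0^x f(t)\,dt \qquad\text{for a.e. } x\in[0,1].$$ Then $\mathsf C$ is a well-defined bounded linear operator on $L^p([0,1])$, and the following hold. - $\mathsf C$ is not power bounded, i.e. $\sup_{n\ge1}\|\mathsf C^n\|=\infty$; in fact $\|\mathsf C^n\|=q^n$ for every integer $n\ge0$. - $\mathsf C$ is not mean ergodic, i.e. the averages $\frac1n\sum_{m=1}^n\mathsf C^m$ do not converge in the strong operator topology to a bounded operator as $n\to\infty$. - $\mathsf C$ is hypercyclic, i.e. there is $f\in L^p([0,1])$ whose orbit $\{\mathsf C^nf: n\ge0\}$ is dense in $L^p([0,1])$; and $\mathsf C$ is chaotic, i.e. it is hypercyclic and the set of its periodic points $\{u\in L^p([0,1]): \mathsf C^nu=u\text{ for some } n\ge1\}$ is dense in $L^p([0,1])$. - The spectrum of $\mathsf C$ is $\sigma(\mathsf C)=\{\lambda\in\mathbb C: |\lambda-\frac q2|\le\frac q2\}$,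 and its point spectrum, i.e. the set of $\lambda\in\mathbb C$ for which $\lambda I-\mathsf C$ is not injective, is $\sigma_{pt}(\mathsf C)=\{\lambda\in\mathbb C: |\lambda-\frac q2|<\frac q2\}$. -/

import Mathlib

open MeasureTheory Filter Topology
open scoped ENNReal

/-- The Cesàro average `x ↦ (1/x) ∫₀ˣ f(t) dt` of a complex-valued function of a real variable
(relevant for `x > 0`). -/
noncomputable def cesaroAverage (f : ℝ → ℂ) (x : ℝ) : ℂ :=
  (1 / (x : ℂ)) * ∫ t in (0 : ℝ)..x, f t

/-- The complex Banach space `L^p([0,1])`, with respect to Lebesgue measure. -/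
abbrev LpUnit (p : ℝ≥0∞) : Type :=
  Lp ℂ p (volume.restrict (Set.Icc (0 : ℝ) 1))

/-- The bounded operator `C` on `L^p([0,1])` is the continuous Cesàro operator: `C f` is the
(class of the) Cesàro average of `f`, for every `f`. Only the values of `f` on `[0,1]` are used,
since the equality is required for almost every `x ∈ [0,1]`. -/
def IsCesaroOperator (p : ℝ≥0∞) [Fact (1 ≤ p)] (C : LpUnit p →L[ℂ] LpUnit p) : Prop :=
  ∀ f : LpUnit p,
    (C f : ℝ → ℂ) =ᵐ[volume.restrict (Set.Icc (0 : ℝ) 1)] cesaroAverage (f : ℝ → ℂ)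

section Operators

variable {X : Type*} [NormedAddCommGroup X] [NormedSpace ℂ X]

/-- `sup_{n ≥ 1} ‖Tⁿ‖ < ∞`. -/
def IsPowerBounded (T : X →L[ℂ] X) : Prop :=
  ∃ M : ℝ, ∀ n : ℕ, 1 ≤ n → ‖T ^ n‖ ≤ M

/-- The averages `T_[n] = (1/n) ∑_{m=1}^n T^m` (used for `n ≥ 1`). -/
noncomputable def ergodicMean (T : X →L[ℂ] X) (n : ℕ) : X →L[ℂ] X :=
  (1 / (n : ℂ)) • ∑ m ∈ Finset.Icc 1 n, T ^ m

/-- The averages `T_[n]` converge, in the strong operator topology, to some bounded operator. -/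
def IsMeanErgodic (T : X →L[ℂ] X) : Prop :=
  ∃ P : X →L[ℂ] X, ∀ x : X, Tendsto (fun n : ℕ => ergodicMean T n x) atTop (𝓝 (P x))

/-- Some orbit `{Tⁿ x : n ≥ 0}` is dense. -/
def IsHypercyclic (T : X →L[ℂ] X) : Prop :=
  ∃ x : X, Dense (Set.range fun n : ℕ => (T ^ n) x)

/-- `T` is hypercyclic and its periodic points are dense. -/
def IsChaotic (T : X →L[ℂ] X) : Prop :=
  IsHypercyclic T ∧ Dense {u : X | ∃ n : ℕ, 1 ≤ n ∧ (T ^ n) u = u}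

/-- The point spectrum: all `z` such that `z I - T` is not injective. -/
def pointSpectrum (T : X →L[ℂ] X) : Set ℂ :=
  {z : ℂ | ¬ Function.Injective (z • ContinuousLinearMap.id ℂ X - T)}

end Operators

/-!
The operators `C_a f = ∫₀¹ sᵃ f(s ·) ds`, for `Re a > -1/q`, are superpositions of dilations. Since
the dilation by `s` has norm at most `s ^ (-1/p)` on `L^p([0,1])`, one gets
`‖C_a‖ ≤ 1 / (Re a + 1/q)` (`exists_weighted_average`), and the powers are eigenvectors:
`C_a x ^ c = x ^ c / (a + c + 1)` for `Re c > -1/p`. Monomials span a dense subspace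
(`dense_span_monomials`), so identities between these operators may be checked on powers. In
particular `C_0` is the Cesàro operator `C`, with `‖C‖ ≤ q` (Hardy's inequality), and
`C_a - C_b = (b - a) C_a C_b` (`resolvent_identity`).

* The eigenvalues `1 / (c + 1)`, for `Re c > -1/p`, fill the open disc with diameter `[0, q]`. Those
  close to `q` give `‖C ^ n‖ ≥ q ^ n`, and a real eigenvalue larger than `1` excludes mean
  ergodicity.
* For `z` outside the closed disc, the resolvent identity exhibits `z⁻¹ + z⁻² C_{-1/z}` as the
  inverse of `z - C`. On the boundary circle `z - C` is injective: if `C f = z f` with `z ≠ 0`, then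
  `f = δ C_{δ - 1/z} f` for all `δ > 0`, and these contractions tend strongly to `0`, as seen on
  monomials; `z = 0` is similar (`eq_zero_of_apply_eq_smul`).
* The map `c ↦ x ^ c` is holomorphic with values in `L^p`, so by the identity theorem the powers with
  exponents in a set accumulating in the half-plane `Re c > -1/p` have dense span
  (`dense_span_powLp`). Applied to the eigenvalues inside, respectively outside, the unit disc this
  gives hypercyclicity by the Godefroy–Shapiro criterion; applied to eigenvalues which are roots of
  unity it gives density of the periodic points.
-/

local notation "μ₀" => volume.restrict (Set.Icc (0 : ℝ) 1)

variable {p : ℝ≥0∞}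

/-! ### Power functions in `L^p([0,1])` -/

lemma ae_pos_le_one : ∀ᵐ x ∂μ₀, 0 < x ∧ x ≤ 1 := by
  rw [Measure.restrict_congr_set (Ioc_ae_eq_Icc (a := (0 : ℝ)) (b := 1)).symm]
  exact ae_restrict_mem measurableSet_Ioc

/-- For finite `p`, `x ^ c` lies in `L^p([0,1])` as soon as `Re c > -1/p`. -/
lemma memLp_cpow (hp : 1 < p) (hp' : p < ∞) {c : ℂ} (hc : -(1 / p.toReal) < c.re) :
    MemLp (fun x : ℝ => (x : ℂ) ^ c) p μ₀ := by
  have hp0 : p ≠ 0 := (zero_lt_one.trans hp).ne'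
  have hpr : 0 < p.toReal := ENNReal.toReal_pos hp0 hp'.ne
  have hmeas : AEStronglyMeasurable (fun x : ℝ => (x : ℂ) ^ c) μ₀ := by
    have : Measurable (fun x : ℝ => (x : ℂ) ^ c) := by fun_prop
    exact this.aestronglyMeasurable
  rw [← integrable_norm_rpow_iff hmeas hp0 hp'.ne]
  have hlt : -1 < c.re * p.toReal := by
    have := mul_lt_mul_of_pos_right hc hpr
    rwa [neg_mul, one_div_mul_cancel hpr.ne'] at this
  have h1 := intervalIntegral.intervalIntegrable_rpow' (a := 0) (b := 1) hlt
  rw [intervalIntegrable_iff_integrableOn_Icc_of_le zero_le_one] at h1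
  refine h1.congr ?_
  filter_upwards [ae_pos_le_one] with x hx
  rw [Complex.norm_cpow_eq_rpow_re_of_pos hx.1, ← Real.rpow_mul hx.1.le]

open Classical in
/-- The class of `x ↦ x ^ c` in `L^p([0,1])`; it is set to `0` when this function is not in
`L^p`. -/
noncomputable def powLp (p : ℝ≥0∞) (c : ℂ) : LpUnit p :=
  if h : MemLp (fun x : ℝ => (x : ℂ) ^ c) p μ₀ then h.toLp else 0

lemma coeFn_powLp (hp : 1 < p) (hp' : p < ∞) {c : ℂ} (hc : -(1 / p.toReal) < c.re) :
    (powLp p c : ℝ → ℂ) =ᵐ[μ₀] fun x : ℝ => (x : ℂ) ^ c := by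
  rw [powLp, dif_pos (memLp_cpow hp hp' hc)]
  exact MemLp.coeFn_toLp _

lemma powLp_ne_zero (hp : 1 < p) (hp' : p < ∞) {c : ℂ} (hc : -(1 / p.toReal) < c.re) :
    powLp p c ≠ 0 := by
  intro h
  have h1 := coeFn_powLp hp hp' hc
  rw [h] at h1
  have h2 : ∀ᵐ x ∂μ₀, False := by
    filter_upwards [h1, ae_pos_le_one, Lp.coeFn_zero ℂ p μ₀] with x hx hx0 hz
    rw [hz, Pi.zero_apply] at hx
    exact (Complex.cpow_ne_zero_iff.2 (Or.inl (by exact_mod_cast hx0.1.ne'))) hx.symm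
  have h3 : (volume.restrict (Set.Icc (0 : ℝ) 1)) Set.univ = 0 := by
    simpa using ae_iff.1 h2
  simp at h3

lemma neg_one_div_toReal_lt (hp : 1 < p) (hp' : p < ∞) {t : ℝ} (ht : 0 ≤ t) :
    -(1 / p.toReal) < t := by
  have hpr : 0 < p.toReal := ENNReal.toReal_pos (zero_lt_one.trans hp).ne' hp'.ne
  have : 0 < 1 / p.toReal := by positivity
  linarith

lemma exists_mem_span_powLp_ae_eq_polynomial [Fact (1 ≤ p)] (hp : 1 < p) (hp' : p < ∞)
    (P : Polynomial ℂ) :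
    ∃ v ∈ Submodule.span ℂ (Set.range fun n : ℕ => powLp p n),
      (v : ℝ → ℂ) =ᵐ[μ₀] fun x : ℝ => P.eval (x : ℂ) := by
  induction P using Polynomial.induction_on' with
  | add P Q hP hQ =>
    obtain ⟨v, hv, hv'⟩ := hP
    obtain ⟨w, hw, hw'⟩ := hQ
    refine ⟨v + w, Submodule.add_mem _ hv hw, ?_⟩
    filter_upwards [hv', hw', Lp.coeFn_add v w] with x h1 h2 h3
    rw [h3, Pi.add_apply, h1, h2, Polynomial.eval_add]
  | monomial n a =>
    refine ⟨a • powLp p n, Submodule.smul_mem _ _ (Submodule.subset_span ⟨n, rfl⟩), ?_⟩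
    filter_upwards [Lp.coeFn_smul a (powLp p n), coeFn_powLp (c := n) hp hp'
      (neg_one_div_toReal_lt hp hp' (by simp))] with x h1 h2
    rw [h1, Pi.smul_apply, h2, Polynomial.eval_monomial, Complex.cpow_natCast, smul_eq_mul]

/-- By Weierstrass, the monomials span a dense subspace of `L^p([0,1])`. -/
lemma dense_span_monomials [Fact (1 ≤ p)] (hp : 1 < p) (hp' : p < ∞) :
    Dense (Submodule.span ℂ (Set.range fun n : ℕ => powLp p n) : Set (LpUnit p)) := by
  intro f
  rw [Metric.mem_closure_iff]
  intro ε hε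
  obtain ⟨g, hg⟩ := (BoundedContinuousFunction.toLp_denseRange (E := ℂ) μ₀ ℂ hp'.ne).exists_dist_lt
    f (half_pos hε)
  have hδ : 0 < ε / 8 := by positivity
  obtain ⟨P, hP⟩ := exists_polynomial_near_of_continuousOn 0 1 (fun x => (g x).re)
    (by fun_prop) (ε / 8) hδ
  obtain ⟨Q, hQ⟩ := exists_polynomial_near_of_continuousOn 0 1 (fun x => (g x).im)
    (by fun_prop) (ε / 8) hδ
  obtain ⟨v, hv, hv'⟩ := exists_mem_span_powLp_ae_eq_polynomial hp hp'
    (P.map Complex.ofRealHom + Polynomial.C Complex.I * Q.map Complex.ofRealHom)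
  refine ⟨v, hv, ?_⟩
  have hbound : ‖BoundedContinuousFunction.toLp p μ₀ ℂ g - v‖ ≤ ε / 4 := by
    have hb : ∀ᵐ x ∂μ₀, ‖(BoundedContinuousFunction.toLp p μ₀ ℂ g - v : LpUnit p) x‖ ≤ ε / 4 := by
      filter_upwards [hv', Lp.coeFn_sub (BoundedContinuousFunction.toLp p μ₀ ℂ g) v,
        BoundedContinuousFunction.coeFn_toLp p μ₀ ℂ g, ae_restrict_mem measurableSet_Icc]
        with x h1 h2 h3 h4
      rw [h2, Pi.sub_apply, h1, h3]
      have e1 := hP x h4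
      have e2 := hQ x h4
      have hev : ∀ R : Polynomial ℝ, (R.map Complex.ofRealHom).eval (x : ℂ) = (R.eval x : ℝ) := by
        intro R
        rw [Polynomial.eval_map]
        exact Polynomial.eval₂_at_apply Complex.ofRealHom x
      rw [Polynomial.eval_add, Polynomial.eval_mul, Polynomial.eval_C, hev, hev]
      refine (Complex.norm_le_abs_re_add_abs_im _).trans ?_
      rw [abs_sub_comm] at e1 e2
      have r1 : (g x - ((P.eval x : ℝ) + Complex.I * (Q.eval x : ℝ))).re
          = (g x).re - P.eval x := by simp
      have r2 : (g x - ((P.eval x : ℝ) + Complex.I * (Q.eval x : ℝ))).im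
          = (g x).im - Q.eval x := by simp
      rw [r1, r2]
      linarith
    have := Lp.norm_le_of_ae_bound (by positivity) hb
    simpa [measureUnivNNReal] using this
  calc dist f v ≤ dist f (BoundedContinuousFunction.toLp p μ₀ ℂ g)
        + dist (BoundedContinuousFunction.toLp p μ₀ ℂ g) v := dist_triangle _ _ _
    _ < ε := by rw [dist_eq_norm _ v]; linarith

/-! ### Dilations and the operators `f ↦ ∫₀¹ sᵃ f(s ·) ds` -/

lemma map_mul_left_restrict_le {s : ℝ} (hs : 0 < s) (hs1 : s ≤ 1) :
    Measure.map (s * ·) μ₀ ≤ ENNReal.ofReal s⁻¹ • μ₀ := by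
  refine Measure.le_iff.2 fun A hA => ?_
  rw [Measure.map_apply (measurable_const_mul s) hA, Measure.smul_apply,
    Measure.restrict_apply (measurable_const_mul s hA), Measure.restrict_apply hA, smul_eq_mul,
    ← abs_of_pos (inv_pos.2 hs), ← Real.volume_preimage_mul_left hs.ne']
  refine measure_mono fun x hx => ⟨hx.1, ?_, ?_⟩
  · exact mul_nonneg hs.le hx.2.1
  · exact mul_le_one₀ hs1 hx.2.1 hx.2.2

/-- The dilation `f ↦ f(s ·)` is bounded on `L^p([0,1])` with norm at most `s ^ (-1/p)`. -/
lemma exists_dilation [Fact (1 ≤ p)] (hp : 1 < p) (hp' : p < ∞) {s : ℝ} (hs : 0 < s)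
    (hs1 : s ≤ 1) :
    ∃ D : LpUnit p →L[ℂ] LpUnit p, (∀ f : LpUnit p, (D f : ℝ → ℂ) =ᵐ[μ₀] fun x => f (s * x)) ∧
      ∀ f : LpUnit p, ‖D f‖ ≤ s ^ (-(1 / p.toReal)) * ‖f‖ := by
  have hp0 : p ≠ 0 := (zero_lt_one.trans hp).ne'
  have hle := map_mul_left_restrict_le hs hs1
  have hac : Measure.map (s * ·) μ₀ ≪ μ₀ := Measure.absolutelyContinuous_of_le_smul hle
  have hqmp : Measure.QuasiMeasurePreserving (s * ·) μ₀ μ₀ := ⟨measurable_const_mul s, hac⟩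
  have hnorm : ∀ f : LpUnit p,
      eLpNorm (fun x => f (s * x)) p μ₀ ≤ ENNReal.ofReal s⁻¹ ^ (1 / p.toReal) * eLpNorm f p μ₀ := by
    intro f
    have h1 := eLpNorm_map_measure (p := p) ((Lp.aestronglyMeasurable f).mono_ac hac)
      (measurable_const_mul s).aemeasurable
    calc eLpNorm (fun x => f (s * x)) p μ₀ = eLpNorm f p (Measure.map (s * ·) μ₀) := h1.symm
      _ ≤ eLpNorm f p (ENNReal.ofReal s⁻¹ • μ₀) := eLpNorm_mono_measure _ hle
      _ = _ := by
        rw [eLpNorm_smul_measure_of_ne_top hp'.ne, smul_eq_mul, one_div, one_div, ENNReal.toReal_inv]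
  have hmem : ∀ f : LpUnit p, MemLp (fun x => f (s * x)) p μ₀ := fun f =>
    ⟨(Lp.aestronglyMeasurable f).comp_quasiMeasurePreserving hqmp,
      (hnorm f).trans_lt (ENNReal.mul_lt_top
        (ENNReal.rpow_lt_top_of_nonneg (by positivity) ENNReal.ofReal_ne_top) (Lp.eLpNorm_lt_top f))⟩
  let D₀ : LpUnit p →ₗ[ℂ] LpUnit p :=
    { toFun := fun f => (hmem f).toLp
      map_add' := fun f g => by
        rw [← MemLp.toLp_add]
        refine MemLp.toLp_congr _ _ ?_
        filter_upwards [hqmp.ae (Lp.coeFn_add f g)] with x hx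
        simpa using hx
      map_smul' := fun a f => by
        rw [RingHom.id_apply, ← MemLp.toLp_const_smul]
        refine MemLp.toLp_congr _ _ ?_
        filter_upwards [hqmp.ae (Lp.coeFn_smul a f)] with x hx
        simpa using hx }
  have hD : ∀ f, ‖D₀ f‖ ≤ s ^ (-(1 / p.toReal)) * ‖f‖ := by
    intro f
    change ‖(hmem f).toLp‖ ≤ _
    rw [Lp.norm_toLp, Lp.norm_def]
    have := ENNReal.toReal_mono (ENNReal.mul_ne_top
      (ENNReal.rpow_ne_top_of_nonneg (by positivity) ENNReal.ofReal_ne_top)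
      (Lp.eLpNorm_ne_top f)) (hnorm f)
    rwa [ENNReal.toReal_mul, ← ENNReal.toReal_rpow, ENNReal.toReal_ofReal (inv_pos.2 hs).le,
      Real.inv_rpow hs.le, ← Real.rpow_neg hs.le] at this
  exact ⟨D₀.mkContinuous _ hD, fun f => (hmem f).coeFn_toLp, hD⟩

/-- For `Re a > -1/q`, the operator `f ↦ ∫₀¹ sᵃ f(s ·) ds` is bounded on `L^p([0,1])`, with norm at
most `1 / (Re a + 1/q)`; here `1/q` is written `1 - 1/p`. These operators are the resolvents of the
generator of the dilation semigroup. Only their action on powers is recorded, since this determines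
them by density. -/
lemma exists_weighted_average [Fact (1 ≤ p)] (hp : 1 < p) (hp' : p < ∞) {a : ℂ}
    (ha : 0 < a.re + (1 - 1 / p.toReal)) :
    ∃ T : LpUnit p →L[ℂ] LpUnit p, ‖T‖ ≤ 1 / (a.re + (1 - 1 / p.toReal)) ∧
      ∀ c : ℂ, -(1 / p.toReal) < c.re → T (powLp p c) = (1 / (a + c + 1)) • powLp p c := by
  have hD : ∀ s : ℝ, 0 < s ∧ s ≤ 1 → ∃ D : LpUnit p →L[ℂ] LpUnit p,
      (∀ f : LpUnit p, (D f : ℝ → ℂ) =ᵐ[μ₀] fun x => f (s * x)) ∧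
      ∀ f : LpUnit p, ‖D f‖ ≤ s ^ (-(1 / p.toReal)) * ‖f‖ :=
    fun s hs => exists_dilation hp hp' hs.1 hs.2
  choose! D hDf hDn using hD
  have hpow : ∀ c : ℂ, -(1 / p.toReal) < c.re → ∀ s : ℝ, 0 < s ∧ s ≤ 1 →
      D s (powLp p c) = (s : ℂ) ^ c • powLp p c := by
    intro c hc s hs
    have hqmp : Measure.QuasiMeasurePreserving (s * ·) μ₀ μ₀ := ⟨measurable_const_mul s,
      Measure.absolutelyContinuous_of_le_smul (map_mul_left_restrict_le hs.1 hs.2)⟩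
    refine Lp.ext ?_
    filter_upwards [hDf s hs (powLp p c), hqmp.ae (coeFn_powLp hp hp' hc), coeFn_powLp hp hp' hc,
      Lp.coeFn_smul ((s : ℂ) ^ c) (powLp p c), ae_pos_le_one] with x h1 h2 h3 h4 h5
    rw [h1, h2, h4, Pi.smul_apply, h3, smul_eq_mul, Complex.ofReal_mul,
      Complex.mul_cpow_ofReal_nonneg hs.1.le h5.1.le]
  -- strong measurability passes from monomials to all of `L^p` by density
  have hmeas : ∀ f : LpUnit p, AEStronglyMeasurable (fun s => D s f) μ₀ := by
    intro f
    have hspan : ∀ v ∈ Submodule.span ℂ (Set.range fun n : ℕ => powLp p n),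
        AEStronglyMeasurable (fun s => D s v) μ₀ := by
      intro v hv
      induction hv using Submodule.span_induction with
      | mem v hv =>
        obtain ⟨n, rfl⟩ := hv
        have h0 : AEStronglyMeasurable (fun s : ℝ => (s : ℂ) ^ (n : ℂ) • powLp p n) μ₀ := by
          refine AEStronglyMeasurable.smul_const ?_ _
          have : Measurable (fun x : ℝ => (x : ℂ) ^ (n : ℂ)) := by fun_prop
          exact this.aestronglyMeasurable
        refine h0.congr ?_
        filter_upwards [ae_pos_le_one] with s hs
        exact (hpow n (neg_one_div_toReal_lt hp hp' (by simp)) s hs).symm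
      | zero => simpa using aestronglyMeasurable_const
      | add v w _ _ hv hw => simpa using! hv.add hw
      | smul b v _ hv => simpa using! hv.const_smul b
    obtain ⟨u, hu, huf⟩ := mem_closure_iff_seq_limit.1 (dense_span_monomials hp hp' f)
    refine aestronglyMeasurable_of_tendsto_ae atTop (fun n => hspan (u n) (hu n)) ?_
    exact Eventually.of_forall fun s => ((D s).continuous.tendsto f).comp huf
  have hexp : -1 < a.re - 1 / p.toReal := by linarith
  have hint : Integrable (fun s : ℝ => s ^ (a.re - 1 / p.toReal)) μ₀ := by
    have h1 := intervalIntegral.intervalIntegrable_rpow' (a := 0) (b := 1) hexp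
    rwa [intervalIntegrable_iff_integrableOn_Icc_of_le zero_le_one] at h1
  have hval : ∫ s : ℝ, s ^ (a.re - 1 / p.toReal) ∂μ₀ = 1 / (a.re + (1 - 1 / p.toReal)) := by
    rw [integral_Icc_eq_integral_Ioc, ← intervalIntegral.integral_of_le zero_le_one,
      integral_rpow (Or.inl hexp), Real.one_rpow, Real.zero_rpow (by linarith)]
    congr 1 <;> ring
  have hbound : ∀ f : LpUnit p, ∀ᵐ s : ℝ ∂μ₀,
      ‖(s : ℂ) ^ a • D s f‖ ≤ s ^ (a.re - 1 / p.toReal) * ‖f‖ := by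
    intro f
    filter_upwards [ae_pos_le_one] with s hs
    rw [norm_smul, Complex.norm_cpow_eq_rpow_re_of_pos hs.1, sub_eq_add_neg, Real.rpow_add hs.1,
      mul_assoc]
    exact mul_le_mul_of_nonneg_left (hDn s hs f) (Real.rpow_nonneg hs.1.le _)
  have hmeas' : ∀ f : LpUnit p, AEStronglyMeasurable (fun s : ℝ => (s : ℂ) ^ a • D s f) μ₀ := by
    intro f
    have : Measurable (fun x : ℝ => (x : ℂ) ^ a) := by fun_prop
    exact this.aestronglyMeasurable.smul (hmeas f)
  have hintg : ∀ f : LpUnit p, Integrable (fun s : ℝ => (s : ℂ) ^ a • D s f) μ₀ := fun f =>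
    (hint.mul_const ‖f‖).mono' (hmeas' f) (hbound f)
  let T₀ : LpUnit p →ₗ[ℂ] LpUnit p :=
    { toFun := fun f => ∫ s : ℝ, (s : ℂ) ^ a • D s f ∂μ₀
      map_add' := fun f g => by
        rw [← integral_add (hintg f) (hintg g)]
        simp
      map_smul' := fun b f => by
        rw [RingHom.id_apply, ← integral_smul]
        simp [smul_comm b] }
  have hT : ∀ f, ‖T₀ f‖ ≤ 1 / (a.re + (1 - 1 / p.toReal)) * ‖f‖ := by
    intro f
    have := norm_integral_le_of_norm_le (hint.mul_const ‖f‖) (hbound f)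
    rwa [integral_mul_const, hval] at this
  refine ⟨T₀.mkContinuous _ hT, LinearMap.mkContinuous_norm_le _ (by positivity) _, ?_⟩
  intro c hc
  change ∫ s : ℝ, (s : ℂ) ^ a • D s (powLp p c) ∂μ₀ = _
  have h1 : ∫ s : ℝ, (s : ℂ) ^ a • D s (powLp p c) ∂μ₀
      = ∫ s : ℝ, (s : ℂ) ^ (a + c) • powLp p c ∂μ₀ := by
    refine integral_congr_ae ?_
    filter_upwards [ae_pos_le_one] with s hs
    rw [hpow c hc s hs, smul_smul, Complex.cpow_add _ _ (by exact_mod_cast hs.1.ne')]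
  have hac : -1 < (a + c).re := by rw [Complex.add_re]; linarith
  have hne : a + c + 1 ≠ 0 := by
    intro h
    have := congrArg Complex.re h
    simp only [Complex.add_re, Complex.one_re, Complex.zero_re] at this hac
    linarith
  rw [h1, integral_smul_const, integral_Icc_eq_integral_Ioc,
    ← intervalIntegral.integral_of_le zero_le_one, integral_cpow (Or.inl hac)]
  simp [Complex.zero_cpow hne]

/-- Operators on `L^p([0,1])` are determined by their values on powers. -/
lemma clm_ext_powLp [Fact (1 ≤ p)] (hp : 1 < p) (hp' : p < ∞) {S T : LpUnit p →L[ℂ] LpUnit p}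
    (h : ∀ c : ℂ, -(1 / p.toReal) < c.re → S (powLp p c) = T (powLp p c)) : S = T := by
  refine ContinuousLinearMap.ext_on (dense_span_monomials hp hp') ?_
  rintro _ ⟨n, rfl⟩
  exact h n (neg_one_div_toReal_lt hp hp' (by simp))

lemma isCesaroOperator_unique [Fact (1 ≤ p)] {S T : LpUnit p →L[ℂ] LpUnit p}
    (hS : IsCesaroOperator p S) (hT : IsCesaroOperator p T) : S = T :=
  ContinuousLinearMap.ext fun f => Lp.ext ((hS f).trans (hT f).symm)

/-- An operator acting on powers like the Cesàro operator is the Cesàro operator: convergence in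
`L^p` gives pointwise convergence of the averages, and almost everywhere convergence, along a
subsequence, of the images. -/
lemma isCesaroOperator_of_powLp [Fact (1 ≤ p)] (hp : 1 < p) (hp' : p < ∞)
    {T : LpUnit p →L[ℂ] LpUnit p}
    (hT : ∀ c : ℂ, -(1 / p.toReal) < c.re → T (powLp p c) = (1 / (c + 1)) • powLp p c) :
    IsCesaroOperator p T := by
  have hL1 : ∀ f : LpUnit p, Integrable f μ₀ := fun f => (Lp.memLp f).integrable hp.le
  have hII : ∀ f : LpUnit p, ∀ x : ℝ, 0 < x ∧ x ≤ 1 → IntervalIntegrable f volume 0 x := by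
    intro f x hx
    rw [intervalIntegrable_iff_integrableOn_Icc_of_le hx.1.le]
    have h1 : IntegrableOn f (Set.Icc 0 1) := hL1 f
    exact h1.mono_set (Set.Icc_subset_Icc_right hx.2)
  have hspan : ∀ v ∈ Submodule.span ℂ (Set.range fun n : ℕ => powLp p n),
      (T v : ℝ → ℂ) =ᵐ[μ₀] cesaroAverage v := by
    intro v hv
    induction hv using Submodule.span_induction with
    | mem v hv =>
      obtain ⟨n, rfl⟩ := hv
      have hn : -(1 / p.toReal) < (n : ℂ).re := neg_one_div_toReal_lt hp hp' (by simp)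
      have hc := coeFn_powLp hp hp' hn
      rw [hT n hn]
      filter_upwards [Lp.coeFn_smul (1 / ((n : ℂ) + 1)) (powLp p n), hc, ae_pos_le_one]
        with x h1 h2 h3
      rw [h1, Pi.smul_apply, h2, cesaroAverage]
      have h4 : ∫ t in (0 : ℝ)..x, powLp p n t = ∫ t in (0 : ℝ)..x, (t : ℂ) ^ (n : ℂ) := by
        rw [intervalIntegral.integral_of_le h3.1.le, intervalIntegral.integral_of_le h3.1.le]
        refine integral_congr_ae ?_
        exact ae_restrict_of_ae_restrict_of_subset
          (Set.Ioc_subset_Icc_self.trans (Set.Icc_subset_Icc_right h3.2)) hc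
      have hx : (x : ℂ) ≠ 0 := by exact_mod_cast h3.1.ne'
      have hn1 : ((n : ℂ) + 1) ≠ 0 := by exact_mod_cast n.succ_ne_zero
      rw [h4, integral_cpow (Or.inl (by simp; linarith [n.cast_nonneg (α := ℝ)])),
        Complex.cpow_add _ _ hx, Complex.ofReal_zero, Complex.zero_cpow hn1, Complex.cpow_one,
        smul_eq_mul]
      field_simp
      simp
    | zero =>
      rw [map_zero]
      filter_upwards [Lp.coeFn_zero ℂ p μ₀, ae_pos_le_one] with x h1 h3
      rw [h1, cesaroAverage, intervalIntegral.integral_of_le h3.1.le]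
      have : (((0 : LpUnit p) : ℝ → ℂ)) =ᵐ[volume.restrict (Set.Ioc 0 x)] 0 :=
        ae_restrict_of_ae_restrict_of_subset
          (Set.Ioc_subset_Icc_self.trans (Set.Icc_subset_Icc_right h3.2)) (Lp.coeFn_zero ℂ p μ₀)
      rw [integral_congr_ae this]
      simp
    | add v w _ _ hv hw =>
      rw [map_add]
      filter_upwards [Lp.coeFn_add (T v) (T w), hv, hw, ae_pos_le_one] with x h1 h2 h3 h4
      rw [h1, Pi.add_apply, h2, h3, cesaroAverage, cesaroAverage, cesaroAverage, ← mul_add,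
        ← intervalIntegral.integral_add (hII v x h4) (hII w x h4)]
      rw [intervalIntegral.integral_of_le h4.1.le, intervalIntegral.integral_of_le h4.1.le]
      congr 1
      refine integral_congr_ae ?_
      exact ae_restrict_of_ae_restrict_of_subset
        (Set.Ioc_subset_Icc_self.trans (Set.Icc_subset_Icc_right h4.2)) (Lp.coeFn_add v w).symm
    | smul b v _ hv =>
      rw [map_smul]
      filter_upwards [Lp.coeFn_smul b (T v), hv, ae_pos_le_one] with x h1 h2 h4
      rw [h1, Pi.smul_apply, h2, cesaroAverage, cesaroAverage, smul_eq_mul, mul_left_comm,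
        ← intervalIntegral.integral_const_mul]
      rw [intervalIntegral.integral_of_le h4.1.le, intervalIntegral.integral_of_le h4.1.le]
      congr 1
      refine integral_congr_ae ?_
      exact ae_restrict_of_ae_restrict_of_subset
        (Set.Ioc_subset_Icc_self.trans (Set.Icc_subset_Icc_right h4.2)) (Lp.coeFn_smul b v).symm
  intro f
  obtain ⟨u, hu, huf⟩ := mem_closure_iff_seq_limit.1 (dense_span_monomials hp hp' f)
  have hTu : Tendsto (fun n => T (u n)) atTop (𝓝 (T f)) := (T.continuous.tendsto f).comp huf
  obtain ⟨φ, hφ, hae⟩ := (tendstoInMeasure_of_tendsto_Lp hTu).exists_seq_tendsto_ae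
  have hall : ∀ᵐ x ∂μ₀, ∀ n, T (u n) x = cesaroAverage (u n) x :=
    ae_all_iff.2 fun n => hspan (u n) (hu n)
  have hnorm1 : Tendsto (fun n => eLpNorm (⇑(u n) - ⇑f) 1 μ₀) atTop (𝓝 0) := by
    have h1 := (Lp.tendsto_Lp_iff_tendsto_eLpNorm' u f).1 huf
    refine tendsto_of_tendsto_of_tendsto_of_le_of_le tendsto_const_nhds h1
      (fun _ => zero_le) fun n => ?_
    have : IsProbabilityMeasure (volume.restrict (Set.Icc (0 : ℝ) 1)) := ⟨by simp⟩
    exact eLpNorm_le_eLpNorm_of_exponent_le hp.le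
      ((Lp.aestronglyMeasurable _).sub (Lp.aestronglyMeasurable _))
  filter_upwards [hae, hall, ae_pos_le_one] with x h1 h2 h3
  refine tendsto_nhds_unique h1 ?_
  simp only [h2]
  refine Tendsto.const_mul _ ?_
  have h4 := tendsto_setIntegral_of_L1' f (Lp.aestronglyMeasurable f)
    (Eventually.of_forall fun n => hL1 (u n)) hnorm1 (Set.Ioc 0 x)
  have h5 : (volume.restrict (Set.Icc (0 : ℝ) 1)).restrict (Set.Ioc 0 x)
      = volume.restrict (Set.Ioc 0 x) := Measure.restrict_restrict_of_subset
    (Set.Ioc_subset_Icc_self.trans (Set.Icc_subset_Icc_right h3.2))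
  simp only [h5] at h4
  simp only [intervalIntegral.integral_of_le h3.1.le]
  exact h4.comp hφ.tendsto_atTop

/-! ### Holomorphy of `c ↦ x ^ c` and density of spans of powers -/

/-- On `(0, 1]`, the remainder of `c ↦ x ^ c` at order two is controlled by a slightly worse
power of `x`. -/
lemma norm_cpow_sub_sub_le {x : ℝ} (hx : 0 < x) (hx1 : x ≤ 1) {r : ℝ} (hr : 0 < r) {c c₀ : ℂ}
    (hc : ‖c - c₀‖ ≤ r) :
    ‖(x : ℂ) ^ c - (x : ℂ) ^ c₀ - (c - c₀) * ((Real.log x : ℂ) * (x : ℂ) ^ c₀)‖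
      ≤ (4 / r ^ 2 * ‖c - c₀‖ ^ 2) * ‖(x : ℂ) ^ (c₀ - 2 * r)‖ := by
  have hx0 : (x : ℂ) ≠ 0 := by exact_mod_cast hx.ne'
  set w : ℂ := (c - c₀) * (Real.log x : ℂ) with hw
  have hxc : (x : ℂ) ^ c = (x : ℂ) ^ c₀ * Complex.exp w := by
    rw [Complex.cpow_def_of_ne_zero hx0, Complex.cpow_def_of_ne_zero hx0, ← Complex.exp_add,
      ← Complex.ofReal_log hx.le, hw]
    congr 1
    ring
  have hlog : Real.log x ≤ 0 := Real.log_nonpos hx.le hx1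
  have hwn : ‖w‖ = ‖c - c₀‖ * |Real.log x| := by
    rw [hw, norm_mul, Complex.norm_real, Real.norm_eq_abs]
  have hexp : Real.exp ‖w‖ ≤ x ^ (-r) := by
    rw [Real.rpow_def_of_pos hx, hwn, abs_of_nonpos hlog]
    refine Real.exp_le_exp.2 ?_
    nlinarith
  have h2 : ‖Complex.exp w - 1 - w‖ ≤ ‖w‖ ^ 2 * Real.exp ‖w‖ := by
    have := Complex.norm_exp_sub_sum_le_norm_mul_exp w 2
    simpa [Finset.sum_range_succ, sub_sub] using this
  have hL : (Real.log x * x ^ (r / 2)) ^ 2 ≤ 4 / r ^ 2 := by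
    have h := (Real.abs_log_mul_self_rpow_lt x (r / 2) hx hx1 (half_pos hr)).le
    rw [← sq_abs]
    calc |Real.log x * x ^ (r / 2)| ^ 2 ≤ (1 / (r / 2)) ^ 2 := by gcongr
      _ = 4 / r ^ 2 := by field_simp; norm_num
  have hre : (c₀ - 2 * (r : ℂ)).re = c₀.re - 2 * r := by simp
  have hsplit : x ^ c₀.re * x ^ (-r) = (x ^ (r / 2)) ^ 2 * x ^ (c₀.re - 2 * r) := by
    rw [← Real.rpow_add hx, ← Real.rpow_natCast, ← Real.rpow_mul hx.le, ← Real.rpow_add hx]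
    congr 1
    push_cast
    ring
  have hfac : (x : ℂ) ^ c - (x : ℂ) ^ c₀ - (c - c₀) * ((Real.log x : ℂ) * (x : ℂ) ^ c₀)
      = (x : ℂ) ^ c₀ * (Complex.exp w - 1 - w) := by
    rw [hxc, hw]
    ring
  rw [hfac, norm_mul, Complex.norm_cpow_eq_rpow_re_of_pos hx,
    Complex.norm_cpow_eq_rpow_re_of_pos hx, hre]
  have hxp : 0 < x ^ c₀.re := Real.rpow_pos_of_pos hx _
  calc x ^ c₀.re * ‖Complex.exp w - 1 - w‖ ≤ x ^ c₀.re * (‖w‖ ^ 2 * x ^ (-r)) := by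
        gcongr
        exact h2.trans (by gcongr)
    _ = (Real.log x * x ^ (r / 2)) ^ 2 * ‖c - c₀‖ ^ 2 * x ^ (c₀.re - 2 * r) := by
      rw [mul_left_comm, hsplit, hwn, mul_pow, sq_abs]
      ring
    _ ≤ (4 / r ^ 2 * ‖c - c₀‖ ^ 2) * x ^ (c₀.re - 2 * r) := by
      have := Real.rpow_nonneg hx.le (c₀.re - 2 * r)
      gcongr

lemma memLp_log_mul_cpow (hp : 1 < p) (hp' : p < ∞) {c : ℂ} (hc : -(1 / p.toReal) < c.re) :
    MemLp (fun x : ℝ => (Real.log x : ℂ) * (x : ℂ) ^ c) p μ₀ := by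
  obtain ⟨r, hr, hrc⟩ : ∃ r : ℝ, 0 < r ∧ -(1 / p.toReal) < c.re - r :=
    ⟨(c.re + 1 / p.toReal) / 2, by linarith, by linarith⟩
  have hmeas : Measurable (fun x : ℝ => (Real.log x : ℂ) * (x : ℂ) ^ c) := by fun_prop
  refine (memLp_cpow (c := c - r) hp hp' (by simpa using hrc)).of_le_mul (c := 1 / r)
    hmeas.aestronglyMeasurable ?_
  filter_upwards [ae_pos_le_one] with x hx
  rw [norm_mul, Complex.norm_cpow_eq_rpow_re_of_pos hx.1, Complex.norm_cpow_eq_rpow_re_of_pos hx.1,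
    Complex.norm_real, Real.norm_eq_abs, Complex.sub_re, Complex.ofReal_re]
  have h1 : x ^ c.re = x ^ r * x ^ (c.re - r) := by
    rw [← Real.rpow_add hx.1]
    congr 1
    ring
  have h2 := (Real.abs_log_mul_self_rpow_lt x r hx.1 hx.2 hr).le
  rw [abs_mul, abs_of_nonneg (Real.rpow_nonneg hx.1.le _)] at h2
  rw [h1, ← mul_assoc]
  exact mul_le_mul_of_nonneg_right h2 (Real.rpow_nonneg hx.1.le _)

/-- The map `c ↦ x ^ c` is holomorphic on `Re c > -1/p` with values in `L^p([0,1])`. -/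
lemma differentiableAt_powLp [Fact (1 ≤ p)] (hp : 1 < p) (hp' : p < ∞) {c₀ : ℂ}
    (hc₀ : -(1 / p.toReal) < c₀.re) : DifferentiableAt ℂ (powLp p) c₀ := by
  obtain ⟨r, hr, hrc⟩ : ∃ r : ℝ, 0 < r ∧ -(1 / p.toReal) < c₀.re - 2 * r :=
    ⟨(c₀.re + 1 / p.toReal) / 4, by linarith, by linarith⟩
  have hD := memLp_log_mul_cpow hp hp' hc₀
  have hre : (c₀ - 2 * (r : ℂ)).re = c₀.re - 2 * r := by simp
  have hrc' : -(1 / p.toReal) < (c₀ - 2 * (r : ℂ)).re := by rwa [hre]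
  have hder : HasDerivAt (powLp p) hD.toLp c₀ := by
    rw [hasDerivAt_iff_isLittleO]
    have hO : (fun c => powLp p c - powLp p c₀ - (c - c₀) • hD.toLp)
        =O[𝓝 c₀] fun c => ‖c - c₀‖ ^ 2 := by
      refine Asymptotics.IsBigO.of_bound (4 / r ^ 2 * ‖powLp p (c₀ - 2 * r)‖) ?_
      filter_upwards [Metric.closedBall_mem_nhds c₀ hr] with c hc
      rw [Metric.mem_closedBall, dist_eq_norm] at hc
      have hcre : -(1 / p.toReal) < c.re := by
        have h1 := (Complex.abs_re_le_norm (c - c₀)).trans hc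
        rw [Complex.sub_re] at h1
        have := abs_le.1 h1
        linarith
      have hle : ‖powLp p c - powLp p c₀ - (c - c₀) • hD.toLp‖
          ≤ (4 / r ^ 2 * ‖c - c₀‖ ^ 2) * ‖powLp p (c₀ - 2 * r)‖ := by
        refine Lp.norm_le_mul_norm_of_ae_le_mul ?_
        filter_upwards [ae_pos_le_one, coeFn_powLp hp hp' hcre, coeFn_powLp hp hp' hc₀,
          coeFn_powLp hp hp' hrc', hD.coeFn_toLp, Lp.coeFn_smul (c - c₀) hD.toLp,
          Lp.coeFn_sub (powLp p c) (powLp p c₀),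
          Lp.coeFn_sub (powLp p c - powLp p c₀) ((c - c₀) • hD.toLp)]
          with x h0 h1 h2 h3 h4 h5 h6 h7
        rw [h7, Pi.sub_apply, h6, Pi.sub_apply, h5, Pi.smul_apply, h4, h1, h2, h3, smul_eq_mul]
        exact norm_cpow_sub_sub_le h0.1 h0.2 hr hc
      refine hle.trans (le_of_eq ?_)
      rw [norm_pow, norm_norm]
      ring
    refine hO.trans_isLittleO ?_
    have h2 : (fun c => ‖c - c₀‖ ^ 2) =o[𝓝 c₀] fun c => c - c₀ := by
      have h3 := (Asymptotics.isLittleO_pow_sub_sub c₀ one_lt_two).norm_left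
      simpa using h3
    exact h2
  exact hder.differentiableAt

/-- The powers `x ^ c`, with `c` ranging over a set accumulating at a point of the half-plane
`Re c > -1/p`, span a dense subspace: modulo the closed span, the holomorphic map `c ↦ x ^ c`
vanishes on a set with an accumulation point, hence at all monomials. -/
lemma dense_span_powLp [Fact (1 ≤ p)] (hp : 1 < p) (hp' : p < ∞) {K : Set ℂ} {c₀ : ℂ}
    (hc₀ : -(1 / p.toReal) < c₀.re) (hK : ∃ᶠ c in 𝓝[≠] c₀, c ∈ K) :
    Dense (Submodule.span ℂ (powLp p '' K) : Set (LpUnit p)) := by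
  set V := (Submodule.span ℂ (powLp p '' K)).topologicalClosure with hV
  have hVc : IsClosed (V : Set (LpUnit p)) := Submodule.isClosed_topologicalClosure _
  have : IsClosed (V.toAddSubgroup : Set (LpUnit p)) := hVc
  let U : Set ℂ := {c | -(1 / p.toReal) < c.re}
  have hUo : IsOpen U := isOpen_lt continuous_const Complex.continuous_re
  have hUc : IsPreconnected U := (convex_halfSpace_re_gt _).isPreconnected
  let Q : ℂ → LpUnit p ⧸ V := fun c => V.mkQL (powLp p c)
  have hQ : AnalyticOnNhd ℂ Q U := by
    refine DifferentiableOn.analyticOnNhd (fun c hc => ?_) hUo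
    exact (V.mkQL.differentiableAt.comp c
      (differentiableAt_powLp hp hp' hc)).differentiableWithinAt
  have hzero : Set.EqOn Q 0 U := by
    refine hQ.eqOn_zero_of_preconnected_of_frequently_eq_zero hUc hc₀ (hK.mono fun c hc => ?_)
    change V.mkQ (powLp p c) = 0
    rw [Submodule.mkQ_apply, Submodule.Quotient.mk_eq_zero]
    exact Submodule.le_topologicalClosure _ (Submodule.subset_span ⟨c, hc, rfl⟩)
  have hmono : (Submodule.span ℂ (Set.range fun n : ℕ => powLp p n)) ≤ V := by
    rw [Submodule.span_le]
    rintro _ ⟨n, rfl⟩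
    have h1 : V.mkQ (powLp p n) = 0 := hzero (neg_one_div_toReal_lt hp hp' (by simp))
    rwa [Submodule.mkQ_apply, Submodule.Quotient.mk_eq_zero] at h1
  have hdense : Dense (V : Set (LpUnit p)) := (dense_span_monomials hp hp').mono hmono
  rw [Submodule.dense_iff_topologicalClosure_eq_top, ← hV, eq_top_iff]
  intro f _
  have hf := hdense f
  rwa [hVc.closure_eq] at hf

/-! ### Dynamics of operators with many eigenvectors -/

section Dynamics

variable {X : Type*} [NormedAddCommGroup X] [NormedSpace ℂ X]

lemma pow_apply_eigenvector {T : X →L[ℂ] X} {v : X} {z : ℂ} (h : T v = z • v) (n : ℕ) :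
    (T ^ n) v = z ^ n • v := by
  induction n with
  | zero => simp
  | succ n ih => rw [pow_succ, mul_apply_eq_comp, h, map_smul, ih, smul_smul,
      pow_succ']

lemma norm_pow_le_of_eigenvector {T : X →L[ℂ] X} {v : X} {z : ℂ} (hv : v ≠ 0) (h : T v = z • v)
    (n : ℕ) : ‖z‖ ^ n ≤ ‖T ^ n‖ := by
  have h1 := (T ^ n).le_opNorm v
  rw [pow_apply_eigenvector h, norm_smul, norm_pow] at h1
  exact le_of_mul_le_mul_right h1 (norm_pos_iff.2 hv)

lemma not_isMeanErgodic_of_eigenvector {T : X →L[ℂ] X} {v : X} {t : ℝ} (hv : v ≠ 0) (ht : 1 < t)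
    (h : T v = (t : ℂ) • v) : ¬ IsMeanErgodic T := by
  rintro ⟨P, hP⟩
  obtain ⟨M, hM⟩ := (hP v).norm.bddAbove_range
  have ht0 : (0 : ℝ) < t := zero_lt_one.trans ht
  -- the `n`-th mean of `v` dominates its last term `(t ^ n / n) • v`
  have hle : ∀ n : ℕ, 1 ≤ n → ‖v‖ ≤ M * ((n : ℝ) ^ 1 / t ^ n) := by
    intro n hn
    have hn0 : (0 : ℝ) < n := by exact_mod_cast hn
    have h1 : ergodicMean T n v = (((1 / (n : ℝ)) * ∑ m ∈ Finset.Icc 1 n, t ^ m : ℝ) : ℂ) • v := by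
      rw [ergodicMean, smul_apply, sum_apply,
        Finset.sum_congr rfl fun m _ => pow_apply_eigenvector h m, ← Finset.sum_smul, smul_smul]
      push_cast
      rfl
    have h2 : ‖ergodicMean T n v‖ ≤ M := hM ⟨n, rfl⟩
    have h3 : t ^ n ≤ ∑ m ∈ Finset.Icc 1 n, t ^ m :=
      Finset.single_le_sum (f := fun m => t ^ m) (fun m _ => (pow_pos ht0 m).le)
        (Finset.mem_Icc.2 ⟨hn, le_rfl⟩)
    have h4 : 0 ≤ ∑ m ∈ Finset.Icc 1 n, t ^ m := (pow_pos ht0 n).le.trans h3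
    rw [h1, norm_smul, Complex.norm_real, Real.norm_of_nonneg (by positivity)] at h2
    have h5 : 1 / (n : ℝ) * t ^ n * ‖v‖ ≤ M := le_trans (by gcongr) h2
    have htn := pow_pos ht0 n
    calc ‖v‖ = (1 / (n : ℝ) * t ^ n * ‖v‖) * ((n : ℝ) ^ 1 / t ^ n) := by field_simp
      _ ≤ _ := by gcongr
  have hlim : Tendsto (fun n : ℕ => M * ((n : ℝ) ^ 1 / t ^ n)) atTop (𝓝 0) := by
    simpa using (tendsto_pow_const_div_const_pow_of_one_lt 1 ht).const_mul M
  have h0 : ‖v‖ ≤ 0 := ge_of_tendsto hlim ((eventually_ge_atTop 1).mono hle)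
  exact hv (norm_le_zero_iff.1 h0)

/-- Birkhoff's transitivity theorem: by Baire, the points whose orbit meets every set of a countable
basis are dense. -/
lemma isHypercyclic_of_transitive [CompleteSpace X] [SecondCountableTopology X] {T : X →L[ℂ] X}
    (h : ∀ U V : Set X, IsOpen U → IsOpen V → U.Nonempty → V.Nonempty →
      ∃ n : ℕ, ∃ x ∈ U, (T ^ n) x ∈ V) : IsHypercyclic T := by
  let B := TopologicalSpace.countableBasis X
  have hB : TopologicalSpace.IsTopologicalBasis B := TopologicalSpace.isBasis_countableBasis X
  have : Countable B := (TopologicalSpace.countable_countableBasis X).to_subtype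
  have hopen : ∀ V : B, IsOpen (⋃ n : ℕ, (fun x => (T ^ n) x) ⁻¹' (V : Set X)) := fun V =>
    isOpen_iUnion fun n => (hB.isOpen V.2).preimage (T ^ n).continuous
  have hdense : ∀ V : B, Dense (⋃ n : ℕ, (fun x => (T ^ n) x) ⁻¹' (V : Set X)) := by
    intro V
    rw [dense_iff_inter_open]
    intro U hU hUne
    obtain ⟨n, x, hxU, hxV⟩ := h U V hU (hB.isOpen V.2) hUne
      (TopologicalSpace.nonempty_of_mem_countableBasis V.2)
    exact ⟨x, hxU, Set.mem_iUnion.2 ⟨n, hxV⟩⟩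
  obtain ⟨x, hx⟩ := (dense_iInter_of_isOpen hopen hdense).nonempty
  refine ⟨x, hB.dense_iff.2 fun V hV _ => ?_⟩
  obtain ⟨n, hn⟩ := Set.mem_iUnion.1 (Set.mem_iInter.1 hx ⟨V, hV⟩)
  exact ⟨(T ^ n) x, hn, n, rfl⟩

lemma tendsto_pow_apply_zero_of_mem_span {T : X →L[ℂ] X} {A : Set X}
    (hA : ∀ v ∈ A, ∃ z : ℂ, ‖z‖ < 1 ∧ T v = z • v) {x : X} (hx : x ∈ Submodule.span ℂ A) :
    Tendsto (fun n : ℕ => (T ^ n) x) atTop (𝓝 0) := by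
  induction hx using Submodule.span_induction with
  | mem v hv =>
    obtain ⟨z, hz, hv⟩ := hA v hv
    simpa [pow_apply_eigenvector hv] using
      (tendsto_pow_atTop_nhds_zero_of_norm_lt_one hz).smul_const v
  | zero => simp
  | add v w _ _ hv hw => simpa using hv.add hw
  | smul b v _ hv => simpa using hv.const_smul b

/-- Combinations of eigenvectors with `1 < ‖z‖` have backward orbits tending to `0`. -/
lemma exists_backward_orbit_of_mem_span {T : X →L[ℂ] X} {A : Set X}
    (hA : ∀ v ∈ A, ∃ z : ℂ, 1 < ‖z‖ ∧ T v = z • v) {x : X} (hx : x ∈ Submodule.span ℂ A) :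
    ∃ u : ℕ → X, Tendsto u atTop (𝓝 0) ∧ ∀ n, (T ^ n) (u n) = x := by
  induction hx using Submodule.span_induction with
  | mem v hv =>
    obtain ⟨z, hz, hv⟩ := hA v hv
    have hz0 : z ≠ 0 := norm_pos_iff.1 (zero_lt_one.trans hz)
    have hz' : ‖z⁻¹‖ < 1 := by rw [norm_inv]; exact inv_lt_one_of_one_lt₀ hz
    refine ⟨fun n => z⁻¹ ^ n • v, ?_, fun n => ?_⟩
    · simpa using (tendsto_pow_atTop_nhds_zero_of_norm_lt_one hz').smul_const v
    · rw [map_smul, pow_apply_eigenvector hv, smul_smul, ← mul_pow, inv_mul_cancel₀ hz0, one_pow,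
        one_smul]
  | zero => exact ⟨0, tendsto_const_nhds, fun n => by simp⟩
  | add v w _ _ hv hw =>
    obtain ⟨u₁, h1, h1'⟩ := hv
    obtain ⟨u₂, h2, h2'⟩ := hw
    exact ⟨fun n => u₁ n + u₂ n, by simpa using h1.add h2, fun n => by rw [map_add, h1', h2']⟩
  | smul b v _ hv =>
    obtain ⟨u, h, h'⟩ := hv
    exact ⟨fun n => b • u n, by simpa using h.const_smul b, fun n => by rw [map_smul, h']⟩

/-- The Godefroy–Shapiro criterion. -/
lemma isHypercyclic_of_dense_span_eigenvectors [CompleteSpace X] [SecondCountableTopology X]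
    {T : X →L[ℂ] X} {A B : Set X}
    (hA : ∀ v ∈ A, ∃ z : ℂ, ‖z‖ < 1 ∧ T v = z • v)
    (hB : ∀ v ∈ B, ∃ z : ℂ, 1 < ‖z‖ ∧ T v = z • v)
    (hAd : Dense (Submodule.span ℂ A : Set X)) (hBd : Dense (Submodule.span ℂ B : Set X)) :
    IsHypercyclic T := by
  refine isHypercyclic_of_transitive fun U V hU hV hUne hVne => ?_
  obtain ⟨x, hxU, hx⟩ := hAd.inter_open_nonempty U hU hUne
  obtain ⟨y, hyV, hy⟩ := hBd.inter_open_nonempty V hV hVne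
  obtain ⟨u, hu, hTu⟩ := exists_backward_orbit_of_mem_span hB hy
  have h1 : Tendsto (fun n => x + u n) atTop (𝓝 x) := by simpa using hu.const_add x
  have h2 : Tendsto (fun n => (T ^ n) (x + u n)) atTop (𝓝 y) := by
    simpa only [map_add, hTu, zero_add] using (tendsto_pow_apply_zero_of_mem_span hA hx).add_const y
  obtain ⟨n, hn1, hn2⟩ :=
    ((h1.eventually (hU.mem_nhds hxU)).and (h2.eventually (hV.mem_nhds hyV))).exists
  exact ⟨n, x + u n, hn1, hn2⟩

lemma pow_mul_apply_of_periodic {T : X →L[ℂ] X} {n : ℕ} {x : X} (h : (T ^ n) x = x) (m : ℕ) :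
    (T ^ (n * m)) x = x := by
  rw [pow_mul]
  simpa using pow_apply_eigenvector (T := T ^ n) (v := x) (z := 1) (by simpa using h) m

lemma dense_periodic_of_dense_span_eigenvectors {T : X →L[ℂ] X} {A : Set X}
    (hA : ∀ v ∈ A, ∃ z : ℂ, (∃ n : ℕ, 1 ≤ n ∧ z ^ n = 1) ∧ T v = z • v)
    (hAd : Dense (Submodule.span ℂ A : Set X)) :
    Dense {u : X | ∃ n : ℕ, 1 ≤ n ∧ (T ^ n) u = u} := by
  refine hAd.mono fun x hx => ?_
  induction hx using Submodule.span_induction with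
  | mem v hv =>
    obtain ⟨z, ⟨n, hn, hz⟩, hv⟩ := hA v hv
    exact ⟨n, hn, by rw [pow_apply_eigenvector hv, hz, one_smul]⟩
  | zero => exact ⟨1, le_rfl, map_zero _⟩
  | add v w _ _ hv hw =>
    obtain ⟨n, hn, hv⟩ := hv
    obtain ⟨m, hm, hw⟩ := hw
    refine ⟨n * m, one_le_mul hn hm, ?_⟩
    rw [map_add, pow_mul_apply_of_periodic hv, mul_comm, pow_mul_apply_of_periodic hw]
  | smul b v _ hv =>
    obtain ⟨n, hn, hv⟩ := hv
    exact ⟨n, hn, by rw [map_smul, hv]⟩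

/-- For uniformly bounded operators, strong convergence may be checked on a set with dense span. -/
lemma tendsto_apply_of_dense_span {G : ℕ → X →L[ℂ] X} {L : X →L[ℂ] X} {M : ℝ}
    (hM : ∀ n, ‖G n‖ ≤ M) {A : Set X} (hAd : Dense (Submodule.span ℂ A : Set X))
    (hA : ∀ v ∈ A, Tendsto (fun n => G n v) atTop (𝓝 (L v))) (x : X) :
    Tendsto (fun n => G n x) atTop (𝓝 (L x)) := by
  have hspan : ∀ v ∈ Submodule.span ℂ A, Tendsto (fun n => G n v) atTop (𝓝 (L v)) := by
    intro v hv
    induction hv using Submodule.span_induction with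
    | mem v hv => exact hA v hv
    | zero => simp
    | add v w _ _ hv hw => simpa using hv.add hw
    | smul b v _ hv => simpa using hv.const_smul b
  rw [Metric.tendsto_atTop]
  intro ε hε
  have hM0 : 0 ≤ M := (norm_nonneg _).trans (hM 0)
  have hδ : 0 < ε / (2 * (M + ‖L‖ + 1)) := by positivity
  obtain ⟨v, hv, hxv⟩ := Metric.mem_closure_iff.1 (hAd x) _ hδ
  obtain ⟨N, hN⟩ := Metric.tendsto_atTop.1 (hspan v hv) (ε / 2) (half_pos hε)
  refine ⟨N, fun n hn => ?_⟩
  have h1 := hN n hn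
  rw [dist_eq_norm] at h1 hxv ⊢
  have h2 : ‖G n (x - v)‖ ≤ M * ‖x - v‖ := (G n).le_of_opNorm_le (hM n) _
  have h3 : ‖L (x - v)‖ ≤ ‖L‖ * ‖x - v‖ := L.le_opNorm _
  have h4 : G n x - L x = G n (x - v) + (G n v - L v) - L (x - v) := by
    rw [map_sub, map_sub]
    abel
  have h5 : (M + ‖L‖ + 1) * ‖x - v‖ < ε / 2 := by
    rw [lt_div_iff₀ (by positivity)] at hxv
    linarith
  calc ‖G n x - L x‖ ≤ ‖G n (x - v)‖ + ‖G n v - L v‖ + ‖L (x - v)‖ := by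
        rw [h4]
        exact (norm_sub_le _ _).trans (add_le_add_left (norm_add_le _ _) _)
    _ < ε := by nlinarith [norm_nonneg (x - v)]

end Dynamics

/-! ### The spectrum of the Cesàro operator -/

lemma norm_sub_half_sq {q : ℝ} {z : ℂ} (hz : z ≠ 0) :
    ‖z - (q : ℂ) / 2‖ ^ 2 = (q / 2) ^ 2 + ‖z‖ ^ 2 * (1 - q * (z⁻¹).re) := by
  have h0 : Complex.normSq z ≠ 0 := (Complex.normSq_pos.2 hz).ne'
  rw [Complex.inv_re, ← Complex.normSq_eq_norm_sq, ← Complex.normSq_eq_norm_sq]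
  field_simp
  rw [Complex.normSq_apply, Complex.normSq_apply]
  simp
  ring

/-- Inversion maps the disc with diameter `[0, q]` onto the half-plane `Re > 1/q`. -/
lemma norm_sub_half_lt_iff {q : ℝ} (hq : 0 < q) {z : ℂ} (hz : z ≠ 0) :
    ‖z - (q : ℂ) / 2‖ < q / 2 ↔ 1 / q < (z⁻¹).re := by
  have h := norm_sub_half_sq (q := q) hz
  have hz2 : 0 < ‖z‖ ^ 2 := by positivity
  rw [← sq_lt_sq₀ (norm_nonneg _) (by positivity), h, div_lt_iff₀' hq]
  constructor
  · intro h1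
    by_contra! h2
    nlinarith [mul_nonneg hz2.le (sub_nonneg.2 h2)]
  · intro h1
    nlinarith [mul_pos hz2 (sub_pos.2 h1)]

lemma lt_norm_sub_half_iff {q : ℝ} (hq : 0 < q) {z : ℂ} (hz : z ≠ 0) :
    q / 2 < ‖z - (q : ℂ) / 2‖ ↔ (z⁻¹).re < 1 / q := by
  have h := norm_sub_half_sq (q := q) hz
  have hz2 : 0 < ‖z‖ ^ 2 := by positivity
  rw [← sq_lt_sq₀ (by positivity) (norm_nonneg _), h, lt_div_iff₀' hq]
  constructor
  · intro h1
    by_contra! h2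
    nlinarith [mul_nonneg hz2.le (sub_nonneg.2 h2)]
  · intro h1
    nlinarith [mul_pos hz2 (sub_pos.2 h1)]

section Cesaro

variable [Fact (1 ≤ p)]

/-- The resolvent identity, checked on powers. -/
lemma resolvent_identity (hp : 1 < p) (hp' : p < ∞) {a b : ℂ}
    (ha : 0 < a.re + (1 - 1 / p.toReal)) (hb : 0 < b.re + (1 - 1 / p.toReal))
    {S T : LpUnit p →L[ℂ] LpUnit p}
    (hS : ∀ c : ℂ, -(1 / p.toReal) < c.re → S (powLp p c) = (1 / (a + c + 1)) • powLp p c)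
    (hT : ∀ c : ℂ, -(1 / p.toReal) < c.re → T (powLp p c) = (1 / (b + c + 1)) • powLp p c) :
    S - T = (b - a) • (S * T) := by
  refine clm_ext_powLp hp hp' fun c hc => ?_
  have h1 : a + c + 1 ≠ 0 := by
    intro h
    have := congrArg Complex.re h
    simp at this
    linarith
  have h2 : b + c + 1 ≠ 0 := by
    intro h
    have := congrArg Complex.re h
    simp at this
    linarith
  rw [sub_apply, smul_apply, mul_apply_eq_comp, hT c hc, map_smul,
    hS c hc, smul_smul, smul_smul, ← sub_smul]
  congr 1
  field_simp
  ring

variable {C : LpUnit p →L[ℂ] LpUnit p}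

/-- The bound `‖C‖ ≤ q` is Hardy's inequality with its sharp constant. -/
lemma exists_isCesaroOperator (hp : 1 < p) (hp' : p < ∞) {q : ℝ}
    (hq : 1 / p.toReal + 1 / q = 1) :
    ∃ C : LpUnit p →L[ℂ] LpUnit p, IsCesaroOperator p C ∧ ‖C‖ ≤ q ∧
      ∀ c : ℂ, -(1 / p.toReal) < c.re → C (powLp p c) = (1 / (c + 1)) • powLp p c := by
  have hpr : 1 < p.toReal := by
    simpa using ENNReal.toReal_strict_mono hp'.ne hp
  have h1 : 1 / p.toReal < 1 := by
    rw [div_lt_one (by linarith)]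
    exact hpr
  obtain ⟨T, hTn, hT⟩ := exists_weighted_average hp hp' (a := 0) (by simpa using h1)
  have hT' : ∀ c : ℂ, -(1 / p.toReal) < c.re → T (powLp p c) = (1 / (c + 1)) • powLp p c := by
    simpa using hT
  refine ⟨T, isCesaroOperator_of_powLp hp hp' hT', hTn.trans (le_of_eq ?_), hT'⟩
  rw [Complex.zero_re, zero_add, sub_eq_of_eq_add' hq.symm, one_div_one_div]

/-- Every point of the open disc is an eigenvalue `1 / (c + 1)`, with eigenvector `x ^ c`. -/
lemma exists_eigenvector (hp : 1 < p) (hp' : p < ∞) {q : ℝ} (hq : 1 / p.toReal + 1 / q = 1)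
    (hq0 : 0 < q)
    (hC : ∀ c : ℂ, -(1 / p.toReal) < c.re → C (powLp p c) = (1 / (c + 1)) • powLp p c)
    {z : ℂ} (hz : ‖z - (q : ℂ) / 2‖ < q / 2) : ∃ v : LpUnit p, v ≠ 0 ∧ C v = z • v := by
  have hz0 : z ≠ 0 := by
    rintro rfl
    rw [zero_sub, norm_neg, norm_div, Complex.norm_real, Real.norm_of_nonneg hq0.le] at hz
    simp at hz
  have hre := (norm_sub_half_lt_iff hq0 hz0).1 hz
  have hc : -(1 / p.toReal) < (z⁻¹ - 1).re := by
    rw [Complex.sub_re, Complex.one_re]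
    linarith
  refine ⟨powLp p (z⁻¹ - 1), powLp_ne_zero hp hp' hc, ?_⟩
  rw [hC _ hc, sub_add_cancel, one_div, inv_inv]

/-- Outside the open disc, `z - C` is injective. If `C f = z f` with `z ≠ 0`, then
`f = δ T f` for the operator `T = ∫₀¹ s ^ (δ - 1/z) f(s ·) ds` and all `δ > 0`; these operators are
contractions converging strongly to `0` as `δ → 0`, since they do so on monomials. For `z = 0` the
same argument works with the approximations `b ∫₀¹ s ^ b f(s ·) ds` of the identity. -/
lemma eq_zero_of_apply_eq_smul (hp : 1 < p) (hp' : p < ∞) {q : ℝ}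
    (hq : 1 / p.toReal + 1 / q = 1) (hq0 : 0 < q)
    (hC : ∀ c : ℂ, -(1 / p.toReal) < c.re → C (powLp p c) = (1 / (c + 1)) • powLp p c)
    {z : ℂ} (hz : q / 2 ≤ ‖z - (q : ℂ) / 2‖) {f : LpUnit p} (hf : C f = z • f) : f = 0 := by
  have hq1 : 1 - 1 / p.toReal = 1 / q := by linarith
  have hqi : 0 < 1 / q := by positivity
  have hC' : ∀ c : ℂ, -(1 / p.toReal) < c.re → C (powLp p c) = (1 / (0 + c + 1)) • powLp p c := by
    simpa using hC
  have h0 : 0 < (0 : ℂ).re + (1 - 1 / p.toReal) := by rw [hq1]; simpa using hq0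
  have hres : ∀ {b : ℂ} {T : LpUnit p →L[ℂ] LpUnit p}, 0 < b.re + (1 - 1 / p.toReal) →
      (∀ c : ℂ, -(1 / p.toReal) < c.re → T (powLp p c) = (1 / (b + c + 1)) • powLp p c) →
      z • f - T f = (b * z) • T f := by
    intro b T hb hT
    have h1 := congrArg (fun S => S f) (resolvent_identity hp hp' hb h0 hT hC')
    rw [zero_sub, neg_smul] at h1
    simp only [sub_apply, neg_apply, smul_apply, mul_apply_eq_comp, hf, map_smul] at h1
    rw [← neg_sub, h1, neg_neg, smul_smul]
  by_cases hz0 : z = 0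
  · subst hz0
    have hb : ∀ k : ℕ, 0 < ((k : ℂ) + 1).re + (1 - 1 / p.toReal) := by
      intro k
      rw [hq1]
      simp only [Complex.add_re, Complex.natCast_re, Complex.one_re]
      positivity
    choose T hTn hT using fun k : ℕ => exists_weighted_average hp hp' (hb k)
    have hTf : ∀ k, T k f = 0 := by
      intro k
      simpa using hres (hb k) (hT k)
    have hlim := tendsto_apply_of_dense_span (G := fun k : ℕ => ((k : ℂ) + 1) • T k)
      (L := ContinuousLinearMap.id ℂ (LpUnit p)) (M := 1) (fun k => ?_)
      (dense_span_monomials hp hp') ?_ f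
    · simp only [smul_apply, hTf, smul_zero, ContinuousLinearMap.id_apply] at hlim
      exact (tendsto_nhds_unique hlim tendsto_const_nhds)
    · rw [norm_smul]
      have h1 : ‖(k : ℂ) + 1‖ = (k : ℝ) + 1 := by
        exact_mod_cast Complex.norm_natCast (k + 1)
      have h2 := hTn k
      rw [hq1] at h2
      simp only [Complex.add_re, Complex.natCast_re, Complex.one_re] at h2
      rw [h1]
      have hk : (0 : ℝ) < (k : ℝ) + 1 := by positivity
      calc ((k : ℝ) + 1) * ‖T k‖ ≤ ((k : ℝ) + 1) * (1 / ((k : ℝ) + 1 + 1 / q)) := by gcongr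
        _ ≤ 1 := by
          rw [mul_one_div, div_le_one (by positivity)]
          linarith
    · rintro _ ⟨n, rfl⟩
      have h1 : Tendsto (fun k : ℕ => ((k : ℂ) + 1) * (1 / ((k : ℂ) + 1 + n + 1))) atTop (𝓝 1) := by
        have h2 : Tendsto (fun k : ℕ => 1 - ((n : ℂ) + 1) * ((k + n + 2 : ℕ) : ℂ)⁻¹) atTop (𝓝 1) := by
          have h3 : Tendsto (fun k : ℕ => ((k + n + 2 : ℕ) : ℂ)⁻¹) atTop (𝓝 0) :=
            (tendsto_inv_atTop_nhds_zero_nat (𝕜 := ℂ)).comp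
              (tendsto_atTop_mono (fun k => by rw [id]; omega) tendsto_id)
          simpa using (h3.const_mul ((n : ℂ) + 1)).const_sub 1
        refine h2.congr fun k => ?_
        have h4 : ((k + n + 2 : ℕ) : ℂ) ≠ 0 := Nat.cast_ne_zero.2 (by omega)
        have h5 : (k : ℂ) + 1 + n + 1 = ((k + n + 2 : ℕ) : ℂ) := by push_cast; ring
        rw [h5]
        field_simp
        push_cast
        ring
      have h6 := h1.smul_const (powLp p n)
      rw [one_smul] at h6
      refine h6.congr fun k => ?_
      rw [smul_apply, hT k _ (neg_one_div_toReal_lt hp hp' (by simp)), smul_smul]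
  · have hre : (z⁻¹).re ≤ 1 / q := by
      by_contra! h
      exact absurd ((norm_sub_half_lt_iff hq0 hz0).2 h) (not_lt.2 hz)
    let δ : ℕ → ℝ := fun k => 1 / ((k : ℝ) + 1)
    have hδ : ∀ k, 0 < δ k := fun k => by positivity
    have hδ0 : Tendsto δ atTop (𝓝 0) := tendsto_one_div_add_atTop_nhds_zero_nat
    have hb : ∀ k : ℕ, δ k ≤ ((δ k : ℂ) - z⁻¹).re + (1 - 1 / p.toReal) := by
      intro k
      rw [hq1, Complex.sub_re, Complex.ofReal_re]
      linarith
    choose T hTn hT using fun k : ℕ => exists_weighted_average hp hp' ((hδ k).trans_le (hb k))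
    have hTf : ∀ k, (δ k : ℂ) • T k f = f := by
      intro k
      have h1 := hres ((hδ k).trans_le (hb k)) (hT k)
      rw [sub_mul, inv_mul_cancel₀ hz0, sub_smul, one_smul, sub_left_inj, mul_comm,
        mul_smul] at h1
      exact (smul_right_injective _ hz0 h1).symm
    have hlim := tendsto_apply_of_dense_span (G := fun k : ℕ => (δ k : ℂ) • T k)
      (L := 0) (M := 1) (fun k => ?_) (dense_span_monomials hp hp') ?_ f
    · simp only [smul_apply, hTf, zero_apply] at hlim
      exact tendsto_nhds_unique tendsto_const_nhds hlim
    · rw [norm_smul, Complex.norm_real, Real.norm_of_nonneg (hδ k).le]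
      calc δ k * ‖T k‖ ≤ δ k * (1 / δ k) :=
            mul_le_mul_of_nonneg_left ((hTn k).trans (one_div_le_one_div_of_le (hδ k) (hb k)))
              (hδ k).le
        _ = 1 := mul_one_div_cancel (hδ k).ne'
    · rintro _ ⟨n, rfl⟩
      have hne : (0 : ℂ) - z⁻¹ + n + 1 ≠ 0 := by
        intro h
        have h1 := congrArg Complex.re h
        simp only [Complex.add_re, Complex.sub_re, Complex.natCast_re, Complex.one_re,
          Complex.zero_re] at h1
        have h2 := neg_one_div_toReal_lt hp hp' (Nat.cast_nonneg (α := ℝ) n)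
        linarith
      have hδc : Tendsto (fun k => (δ k : ℂ)) atTop (𝓝 0) := by
        simpa [Function.comp_def] using (Complex.continuous_ofReal.tendsto 0).comp hδ0
      have h1 : Tendsto (fun k : ℕ => (δ k : ℂ) * (1 / ((δ k : ℂ) - z⁻¹ + n + 1))) atTop
          (𝓝 (0 * (1 / ((0 : ℂ) - z⁻¹ + n + 1)))) :=
        hδc.mul (tendsto_const_nhds.div (((hδc.sub_const _).add_const _).add_const _) hne)
      have h6 := h1.smul_const (powLp p n)
      rw [zero_mul, zero_smul] at h6
      refine h6.congr fun k => ?_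
      rw [smul_apply, hT k _ (neg_one_div_toReal_lt hp hp' (by simp)), smul_smul]

lemma pointSpectrum_cesaro (hp : 1 < p) (hp' : p < ∞) {q : ℝ}
    (hq : 1 / p.toReal + 1 / q = 1) (hq0 : 0 < q)
    (hC : ∀ c : ℂ, -(1 / p.toReal) < c.re → C (powLp p c) = (1 / (c + 1)) • powLp p c) :
    pointSpectrum C = {z : ℂ | ‖z - (q : ℂ) / 2‖ < q / 2} := by
  ext z
  simp only [pointSpectrum, Set.mem_ofPred_eq]
  constructor
  · intro h
    by_contra! hz
    refine h ((injective_iff_map_eq_zero _).2 fun f hf => ?_)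
    refine eq_zero_of_apply_eq_smul hp hp' hq hq0 hC hz (f := f) ?_
    exact (sub_eq_zero.1 (by simpa using hf)).symm
  · intro hz h
    obtain ⟨v, hv, hCv⟩ := exists_eigenvector hp hp' hq hq0 hC hz
    exact hv ((injective_iff_map_eq_zero _).1 h v (by simp [hCv]))

/-- For `z` outside the closed disc, the inverse of `z - C` is `z⁻¹ + z⁻² T`, with `T` the weighted
average of exponent `-1/z`. -/
lemma notMem_spectrum_cesaro (hp : 1 < p) (hp' : p < ∞) {q : ℝ}
    (hq : 1 / p.toReal + 1 / q = 1) (hq0 : 0 < q)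
    (hC : ∀ c : ℂ, -(1 / p.toReal) < c.re → C (powLp p c) = (1 / (c + 1)) • powLp p c)
    {z : ℂ} (hz : q / 2 < ‖z - (q : ℂ) / 2‖) : z ∉ spectrum ℂ C := by
  have hq1 : 1 - 1 / p.toReal = 1 / q := by linarith
  have hz0 : z ≠ 0 := by
    rintro rfl
    rw [zero_sub, norm_neg, norm_div, Complex.norm_real, Real.norm_of_nonneg hq0.le] at hz
    simp at hz
  have hC' : ∀ c : ℂ, -(1 / p.toReal) < c.re → C (powLp p c) = (1 / (0 + c + 1)) • powLp p c := by
    simpa using hC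
  have h0 : 0 < (0 : ℂ).re + (1 - 1 / p.toReal) := by rw [hq1]; simpa using hq0
  have hb : 0 < (-z⁻¹).re + (1 - 1 / p.toReal) := by
    rw [hq1, Complex.neg_re]
    linarith [(lt_norm_sub_half_iff hq0 hz0).1 hz]
  obtain ⟨T, -, hT⟩ := exists_weighted_average hp hp' hb
  have e1 := resolvent_identity hp hp' h0 hb hC' hT
  have e2 := resolvent_identity hp hp' hb h0 hT hC'
  rw [sub_zero, neg_smul] at e1
  rw [zero_sub, neg_neg] at e2
  have m1 : C * T = z • (T - C) := by
    rw [← neg_sub, e1, neg_neg, smul_smul, mul_inv_cancel₀ hz0, one_smul]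
  have m2 : T * C = z • (T - C) := by
    rw [e2, smul_smul, mul_inv_cancel₀ hz0, one_smul]
  rw [spectrum.notMem_iff, Algebra.algebraMap_eq_smul_one]
  have i1 : (z • 1 - C) * (z⁻¹ • 1 + (z⁻¹ * z⁻¹) • T) = 1 := by
    rw [sub_mul, mul_add, mul_add, smul_mul_smul_comm, smul_mul_smul_comm, mul_smul_comm,
      mul_smul_comm, m1, mul_inv_cancel₀ hz0, smul_smul, mul_assoc z⁻¹, inv_mul_cancel₀ hz0,
      mul_inv_cancel_left₀ hz0]
    simp only [mul_one, one_mul, smul_sub, one_smul]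
    abel
  have i2 : (z⁻¹ • 1 + (z⁻¹ * z⁻¹) • T) * (z • 1 - C) = 1 := by
    rw [mul_sub, add_mul, add_mul, smul_mul_smul_comm, smul_mul_smul_comm, smul_mul_assoc,
      smul_mul_assoc, m2, inv_mul_cancel₀ hz0, smul_smul, mul_assoc z⁻¹, inv_mul_cancel₀ hz0,
      mul_one, mul_one, one_mul, mul_one, smul_sub, one_smul]
    abel
  exact ⟨⟨_, _, i1, i2⟩, rfl⟩

lemma spectrum_cesaro (hp : 1 < p) (hp' : p < ∞) {q : ℝ}
    (hq : 1 / p.toReal + 1 / q = 1) (hq0 : 0 < q)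
    (hC : ∀ c : ℂ, -(1 / p.toReal) < c.re → C (powLp p c) = (1 / (c + 1)) • powLp p c) :
    spectrum ℂ C = {z : ℂ | ‖z - (q : ℂ) / 2‖ ≤ q / 2} := by
  refine Set.Subset.antisymm (fun z hz => ?_) ?_
  · by_contra h
    exact notMem_spectrum_cesaro hp hp' hq hq0 hC (not_le.1 h) hz
  · have hball : Metric.ball ((q : ℂ) / 2) (q / 2) ⊆ spectrum ℂ C := by
      intro z hz
      rw [Metric.mem_ball, dist_eq_norm] at hz
      obtain ⟨v, hv, hCv⟩ := exists_eigenvector hp hp' hq hq0 hC hz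
      rw [spectrum.mem_iff]
      rintro ⟨u, hu⟩
      refine hv ?_
      have h1 : (u : LpUnit p →L[ℂ] LpUnit p) v = 0 := by
        rw [hu, Algebra.algebraMap_eq_smul_one]
        simp [hCv]
      have h2 : ((↑u⁻¹ * ↑u : LpUnit p →L[ℂ] LpUnit p)) v = v := by simp
      rw [← h2, mul_apply_eq_comp, h1, map_zero]
    have hcl := closure_minimal hball (spectrum.isClosed (𝕜 := ℂ) C)
    rw [closure_ball _ (by positivity)] at hcl
    intro z hz
    exact hcl (by rw [Metric.mem_closedBall, dist_eq_norm]; exact hz)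

/-! ### Norms of the powers, hypercyclicity and chaos -/

lemma norm_sub_half_lt_of_mem_Ioo {q t : ℝ} (ht : t ∈ Set.Ioo 0 q) :
    ‖(t : ℂ) - (q : ℂ) / 2‖ < q / 2 := by
  have h : (t : ℂ) - (q : ℂ) / 2 = ((t - q / 2 : ℝ) : ℂ) := by push_cast; rfl
  rw [h, Complex.norm_real, Real.norm_eq_abs, abs_lt]
  constructor <;> linarith [ht.1, ht.2]

lemma norm_pow_cesaro (hp : 1 < p) (hp' : p < ∞) {q : ℝ}
    (hq : 1 / p.toReal + 1 / q = 1) (hq0 : 0 < q)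
    (hC : ∀ c : ℂ, -(1 / p.toReal) < c.re → C (powLp p c) = (1 / (c + 1)) • powLp p c)
    (hCn : ‖C‖ ≤ q) (n : ℕ) : ‖C ^ n‖ = q ^ n := by
  have : Nontrivial (LpUnit p) :=
    ⟨powLp p 0, 0, powLp_ne_zero hp hp' (neg_one_div_toReal_lt hp hp' (by simp))⟩
  refine le_antisymm ((norm_pow_le C n).trans (by gcongr)) ?_
  -- the eigenvalues in `(0, q)` give the lower bound
  have h1 : Tendsto (fun t : ℝ => t ^ n) (𝓝[<] q) (𝓝 (q ^ n)) :=
    ((continuous_pow n).tendsto q).mono_left nhdsWithin_le_nhds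
  refine le_of_tendsto h1 ?_
  filter_upwards [Ioo_mem_nhdsLT hq0] with t ht
  obtain ⟨v, hv, hCv⟩ := exists_eigenvector hp hp' hq hq0 hC (norm_sub_half_lt_of_mem_Ioo ht)
  have := norm_pow_le_of_eigenvector hv hCv n
  rwa [Complex.norm_real, Real.norm_of_nonneg ht.1.le] at this

lemma eventually_re_gt {a : ℝ} {c₀ : ℂ} (h : a < c₀.re) : ∀ᶠ c in 𝓝[≠] c₀, a < c.re :=
  (Complex.continuous_re.continuousAt.eventually_const_lt h).filter_mono nhdsWithin_le_nhds

lemma isHypercyclic_cesaro (hp : 1 < p) (hp' : p < ∞)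
    (hC : ∀ c : ℂ, -(1 / p.toReal) < c.re → C (powLp p c) = (1 / (c + 1)) • powLp p c) :
    IsHypercyclic C := by
  have : Fact (p ≠ ∞) := ⟨hp'.ne⟩
  have hpr : 1 < p.toReal := by simpa using ENNReal.toReal_strict_mono hp'.ne hp
  have hp1 : 0 < 1 / p.toReal := by positivity
  have hp2 : 1 / p.toReal < 1 := by rwa [div_lt_one (by linarith)]
  have hcont : ∀ {c₀ : ℂ}, c₀ + 1 ≠ 0 → ContinuousAt (fun c : ℂ => ‖1 / (c + 1)‖) c₀ := by
    intro c₀ h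
    fun_prop (disch := assumption)
  let K₀ : Set ℂ := {c | -(1 / p.toReal) < c.re ∧ ‖1 / (c + 1)‖ < 1}
  let K₁ : Set ℂ := {c | -(1 / p.toReal) < c.re ∧ 1 < ‖1 / (c + 1)‖}
  have hK₀ : ∃ᶠ c in 𝓝[≠] (1 : ℂ), c ∈ K₀ := by
    refine ((eventually_re_gt (neg_one_div_toReal_lt hp hp' (by simp))).and ?_).frequently
    refine ((hcont (by norm_num)).eventually_lt_const ?_).filter_mono nhdsWithin_le_nhds
    norm_num
  have hre : -(1 / p.toReal) < ((-(1 / p.toReal) / 2 : ℝ) : ℂ).re := by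
    rw [Complex.ofReal_re]
    linarith
  have hK₁ : ∃ᶠ c in 𝓝[≠] ((-(1 / p.toReal) / 2 : ℝ) : ℂ), c ∈ K₁ := by
    have h1 : ((-(1 / p.toReal) / 2 : ℝ) : ℂ) + 1 = ((1 - 1 / p.toReal / 2 : ℝ) : ℂ) := by
      push_cast
      ring
    have h2 : 0 < 1 - 1 / p.toReal / 2 := by linarith
    refine ((eventually_re_gt hre).and ?_).frequently
    refine ((hcont ?_).eventually_const_lt ?_).filter_mono nhdsWithin_le_nhds
    · rw [h1]
      exact_mod_cast h2.ne'
    · change 1 < ‖1 / (((-(1 / p.toReal) / 2 : ℝ) : ℂ) + 1)‖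
      rw [h1, norm_div, norm_one, Complex.norm_real, Real.norm_of_nonneg h2.le, lt_div_iff₀ h2]
      linarith
  refine isHypercyclic_of_dense_span_eigenvectors (A := powLp p '' K₀) (B := powLp p '' K₁) ?_ ?_
    (dense_span_powLp hp hp' (neg_one_div_toReal_lt hp hp' (by simp)) hK₀)
    (dense_span_powLp hp hp' hre hK₁)
  · rintro _ ⟨c, hc, rfl⟩
    exact ⟨_, hc.2, hC c hc.1⟩
  · rintro _ ⟨c, hc, rfl⟩
    exact ⟨_, hc.2, hC c hc.1⟩

lemma dense_periodic_cesaro (hp : 1 < p) (hp' : p < ∞)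
    (hC : ∀ c : ℂ, -(1 / p.toReal) < c.re → C (powLp p c) = (1 / (c + 1)) • powLp p c) :
    Dense {u : LpUnit p | ∃ n : ℕ, 1 ≤ n ∧ (C ^ n) u = u} := by
  let K : Set ℂ := {c | -(1 / p.toReal) < c.re ∧ ∃ n : ℕ, 1 ≤ n ∧ (1 / (c + 1)) ^ n = 1}
  have h0 : -(1 / p.toReal) < (0 : ℂ).re := neg_one_div_toReal_lt hp hp' (by simp)
  have hK : ∃ᶠ c in 𝓝[≠] (0 : ℂ), c ∈ K := by
    -- the points `ζ - 1`, for the primitive roots of unity `ζ` closest to `1`, tend to `0`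
    let ζ : ℕ → ℂ := fun k => Complex.exp (2 * Real.pi * Complex.I / ((k + 2 : ℕ) : ℂ))
    have hζ : ∀ k, IsPrimitiveRoot (ζ k) (k + 2) := fun k =>
      Complex.isPrimitiveRoot_exp (k + 2) (by omega)
    have hlim : Tendsto (fun k => ζ k - 1) atTop (𝓝[≠] 0) := by
      refine tendsto_nhdsWithin_iff.2 ⟨?_, Eventually.of_forall fun k => ?_⟩
      · have h1 : Tendsto (fun k : ℕ => 2 * Real.pi * Complex.I / ((k + 2 : ℕ) : ℂ)) atTop (𝓝 0) :=
          (tendsto_const_div_atTop_nhds_zero_nat _).comp (tendsto_add_atTop_nat 2)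
        have h2 := ((Complex.continuous_exp.tendsto 0).comp h1).sub_const 1
        rw [Complex.exp_zero, sub_self] at h2
        exact h2
      · exact sub_ne_zero.2 ((hζ k).ne_one (by omega))
    refine hlim.frequently (Eventually.frequently ?_)
    filter_upwards [hlim.eventually (eventually_re_gt h0)] with k hk
    refine ⟨hk, k + 2, by omega, ?_⟩
    rw [sub_add_cancel, div_pow, (hζ k).pow_eq_one, one_pow, div_one]
  refine dense_periodic_of_dense_span_eigenvectors (A := powLp p '' K) ?_
    (dense_span_powLp hp hp' h0 hK)
  rintro _ ⟨c, hc, rfl⟩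
  exact ⟨_, hc.2, hC c hc.1⟩

end Cesaro

theorem theorem3p1 (p : ℝ≥0∞) [Fact (1 ≤ p)] (hp : 1 < p) (hp' : p < ∞)
    (q : ℝ) (hq : 1 / p.toReal + 1 / q = 1) :
    (∃! C : LpUnit p →L[ℂ] LpUnit p, IsCesaroOperator p C) ∧
    ∀ C : LpUnit p →L[ℂ] LpUnit p, IsCesaroOperator p C →
      ¬ IsPowerBounded C ∧
      ¬ IsMeanErgodic C ∧
      (∀ n : ℕ, ‖C ^ n‖ = q ^ n) ∧
      IsHypercyclic C ∧
      IsChaotic C ∧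
      spectrum ℂ C = {z : ℂ | ‖z - (q : ℂ) / 2‖ ≤ q / 2} ∧
      pointSpectrum C = {z : ℂ | ‖z - (q : ℂ) / 2‖ < q / 2} := by
  have hpr : 1 < p.toReal := by simpa using ENNReal.toReal_strict_mono hp'.ne hp
  have hp1 : 0 < 1 / p.toReal := by positivity
  have hp2 : 1 / p.toReal < 1 := by rwa [div_lt_one (by linarith)]
  have hq0 : 0 < q := one_div_pos.1 (by linarith)
  have hq1 : 1 < q := (one_div_lt_one_div hq0 one_pos).1 (by linarith)
  obtain ⟨C₀, hC₀, hCn, hC⟩ := exists_isCesaroOperator hp hp' hq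
  refine ⟨⟨C₀, hC₀, fun D hD => isCesaroOperator_unique hD hC₀⟩, fun D hD => ?_⟩
  obtain rfl := isCesaroOperator_unique hD hC₀
  have hnorm := norm_pow_cesaro hp hp' hq hq0 hC hCn
  have hhyp := isHypercyclic_cesaro hp hp' hC
  refine ⟨?_, ?_, hnorm, hhyp, ⟨hhyp, dense_periodic_cesaro hp hp' hC⟩,
    spectrum_cesaro hp hp' hq hq0 hC, pointSpectrum_cesaro hp hp' hq hq0 hC⟩
  · rintro ⟨M, hM⟩
    obtain ⟨n, hMn, hn⟩ := (((tendsto_pow_atTop_atTop_of_one_lt hq1).eventually_gt_atTop M).and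
      (eventually_ge_atTop 1)).exists
    exact absurd (hM n hn) (by rw [hnorm]; exact not_le.2 hMn)
  · obtain ⟨v, hv, hCv⟩ := exists_eigenvector hp hp' hq hq0 hC
      (norm_sub_half_lt_of_mem_Ioo (t := (1 + q) / 2) ⟨by linarith, by linarith⟩)
    exact not_isMeanErgodic_of_eigenvector hv (by linarith) hCv
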